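/- Let $\mathbb{D}=\{z\in\mathbb{C}:|z|<1\}$. For a harmonic mapping $f:\mathbb{D}\to\mathbb{C}$ (real and imaginary parts harmonic) put $$\Lambda_f=|f_z|+|f_{\bar z}|,\qquad \lambda_f=\bigl||f_z|-|f_{\bar z}|\bigr|,\qquad J_f=|f_z|^2-|f_{\bar z}|^2,$$ $$l_f(r)=r\int_0^{2\pi}\bigl|f_z(re^{i\theta})-e^{-2i\theta}f_{\bar z}(re^{i\theta})\bigr|\,d\theta\quad(0<r<1),\qquad l_f(1)=\sup_{0<r<1}l_f(r),$$ $$\beta_f=\sup_{z,w\in\mathbb{D},\,z\ne w}\frac{|f(z)-f(w)|}{\rho(z,w)},\qquad \rho(z,w)=\operatorname{arctanh}\left|\frac{z-w}{1-\bar z w}\right| ,$$ and call $f$ a harmonic Bloch mapping if $\beta_f<\infty$. For $K\in[1,\infty)$, $f$ is called a sense-preserving $K$-quasiconformal harmonic mapping of $\mathbb{D}$ if $f$ is harmonic and injective in $\mathbb{D}$, with $J_f>0$ and $\Lambda_f\le K\lambda_f$ in $\mathbb{D}$. **Theorem.** Let $f(z)=\sum_{n=0}^\infty a_nz^n+\sum_{n=1}^\infty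 \bar b_n\bar z^n$ be a sense-preserving $K$-quasiconformal harmonic mapping of $\mathbb{D}$ with $l_f(1)<\infty$. Then $$|a_n|+|b_n|\le\frac{K\,l_f(1)}{2n\pi}\quad(n\ge1)\qquad\text{and}\qquad \Lambda_f(z)\le\frac{l_f(1)\sqrt K}{2\pi(1-|z|)}\quad(z\in\mathbb{D}).$$ Moreover, $f$ is a harmonic Bloch mapping and $\beta_f\le l_f(1)\sqrt K/\pi$. If $K=1$, the first two estimates are sharp: the function $f(z)=z$ satisfies the hypotheses with $K=1$ and attains equality in the first estimate for $n=1$ and in the second one at $z=0$. -/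

import Mathlib

noncomputable section

namespace PlanarHarmonic

open scoped ENNReal ComplexConjugate

/-- The open unit disk. -/
def unitDisk : Set ℂ := Metric.ball 0 1

/-- The Wirtinger derivative `f_z = (f_x - i f_y) / 2`. -/
def dz (f : ℂ → ℂ) (z : ℂ) : ℂ :=
  (fderiv ℝ f z 1 - Complex.I * fderiv ℝ f z Complex.I) / 2

/-- The Wirtinger derivative `f_{z̄} = (f_x + i f_y) / 2`. -/
def dzbar (f : ℂ → ℂ) (z : ℂ) : ℂ :=
  (fderiv ℝ f z 1 + Complex.I * fderiv ℝ f z Complex.I) / 2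

/-- `Λ_f(z) = |f_z(z)| + |f_{z̄}(z)|`. -/
def bigLambda (f : ℂ → ℂ) (z : ℂ) : ℝ := ‖dz f z‖ + ‖dzbar f z‖

/-- `λ_f(z) = | |f_z(z)| - |f_{z̄}(z)| |`. -/
def smallLambda (f : ℂ → ℂ) (z : ℂ) : ℝ := |‖dz f z‖ - ‖dzbar f z‖|

/-- The Jacobian `J_f = |f_z|² - |f_{z̄}|²`. -/
def jacobian (f : ℂ → ℂ) (z : ℂ) : ℝ := ‖dz f z‖ ^ 2 - ‖dzbar f z‖ ^ 2

/-- A harmonic mapping of the unit disk: the real and imaginary parts are harmonic. -/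
def IsHarmonicMapping (f : ℂ → ℂ) : Prop :=
  InnerProductSpace.HarmonicOnNhd (fun z => (f z).re) unitDisk ∧
    InnerProductSpace.HarmonicOnNhd (fun z => (f z).im) unitDisk

/-- Positive Jacobian, i.e. locally univalent and sense-preserving in the disk. -/
def IsSensePreserving (f : ℂ → ℂ) : Prop := ∀ z ∈ unitDisk, 0 < jacobian f z

/-- A sense-preserving `K`-quasiconformal harmonic mapping of the unit disk, `K ∈ [1, ∞)`. -/
structure IsQuasiconformalHarmonic (K : ℝ) (f : ℂ → ℂ) : Prop where
  one_le : 1 ≤ K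
  harmonic : IsHarmonicMapping f
  sensePreserving : IsSensePreserving f
  quasiregular : ∀ z ∈ unitDisk, bigLambda f z ≤ K * smallLambda f z
  univalent : Set.InjOn f unitDisk

/-- The expansion `f(z) = ∑_{n ≥ 0} a_n zⁿ + ∑_{n ≥ 1} conj(b_n) conj(z)ⁿ` on the unit disk,
both series being convergent there (the second sum is indexed by `n + 1`, so `b 0` is unused). -/
def HasHarmonicExpansion (f : ℂ → ℂ) (a b : ℕ → ℂ) : Prop :=
  ∀ z ∈ unitDisk,
    Summable (fun n : ℕ => a n * z ^ n) ∧
    Summable (fun n : ℕ => conj (b (n + 1)) * conj z ^ (n + 1)) ∧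
    f z = (∑' n : ℕ, a n * z ^ n) + ∑' n : ℕ, conj (b (n + 1)) * conj z ^ (n + 1)

/-- The length, counting multiplicity, of the image of the circle of radius `r`:
`l_f(r) = r ∫_0^{2π} |f_z(r e^{iθ}) - e^{-2iθ} f_{z̄}(r e^{iθ})| dθ`. -/
def circleLength (f : ℂ → ℂ) (r : ℝ) : ℝ :=
  r * ∫ θ in (0 : ℝ)..(2 * Real.pi),
    ‖dz f (r * Complex.exp (θ * Complex.I)) -
      Complex.exp (-2 * θ * Complex.I) * dzbar f (r * Complex.exp (θ * Complex.I))‖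

/-- `l_f(1) = sup_{0 < r < 1} l_f(r)`, possibly infinite. -/
def boundaryLength (f : ℂ → ℂ) : ℝ≥0∞ :=
  ⨆ r ∈ Set.Ioo (0 : ℝ) 1, ENNReal.ofReal (circleLength f r)

/-- The hyperbolic distance of the unit disk, `arctanh |(z - w) / (1 - conj(z) w)|`. -/
def hypDist (z w : ℂ) : ℝ :=
  1 / 2 * Real.log ((1 + ‖(z - w) / (1 - conj z * w)‖) / (1 - ‖(z - w) / (1 - conj z * w)‖))

/-- The Lipschitz number `β_f = sup_{z ≠ w} |f(z) - f(w)| / ρ(z, w)`, possibly infinite. -/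
def lipschitzNumber (f : ℂ → ℂ) : ℝ≥0∞ :=
  ⨆ (z ∈ unitDisk) (w ∈ unitDisk) (_ : z ≠ w), ENNReal.ofReal (‖f z - f w‖ / hypDist z w)

/-- Harmonic Bloch mappings: harmonic mappings of the disk with finite Lipschitz number. -/
def IsHarmonicBloch (f : ℂ → ℂ) : Prop := IsHarmonicMapping f ∧ lipschitzNumber f < ∞

end PlanarHarmonic

end

/-!
By the isoperimetric inequality and Green's theorem the image of `|z| < r`, counted with
multiplicity, has area at most `l_f(r)² / 4π`. Since `Λ_f² ≤ K J_f`, this also bounds the integral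
of `Λ_f²` over `|z| < r`. For `|c| = 1` the function `f_z + c conj f_{z̄}` is holomorphic with
modulus at most `Λ_f`, and at a given point a suitable `c` gives equality. The mean value property
of its square on disks about `z` of radius up to `1 - |z|` therefore yields the pointwise bound,
which integrates along the hyperbolic geodesic from `z` to `w` to the Lipschitz estimate. Writing
`f = h + conj g`, the coefficient estimate is Cauchy's estimate for the derivative of `h + c g`.
-/

noncomputable section

namespace PlanarHarmonic

open Filter MeasureTheory Metric Set
open Complex (I)
open scoped ComplexConjugate ENNReal Real Topology

section Isoperimetric

theorem memLp_restrict_Ioc_of_continuousOn {E : Type*} [NormedAddCommGroup E] {p : ℝ≥0∞} {a b : ℝ}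
    {u : ℝ → E} (hu : ContinuousOn u (Icc a b)) : MemLp u p (volume.restrict (Ioc a b)) := by
  obtain ⟨M, hM⟩ := isCompact_Icc.exists_bound_of_continuousOn hu
  refine MemLp.of_bound ((hu.mono Ioc_subset_Icc_self).aestronglyMeasurable measurableSet_Ioc) M ?_
  filter_upwards [ae_restrict_mem measurableSet_Ioc] with x hx
  exact hM x (Ioc_subset_Icc_self hx)

theorem norm_fourierCoeffOn_le_of_hasDerivAt {a b : ℝ} (hab : a < b) {u u' : ℝ → ℂ}
    (hu : ∀ x ∈ uIcc a b, HasDerivAt u (u' x) x) (hu' : IntervalIntegrable u' volume a b)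
    (hclosed : u b = u a) (hmean : ∫ x in a..b, u x = 0) (n : ℤ) :
    ‖fourierCoeffOn hab u n‖ ≤ (b - a) / (2 * π) * ‖fourierCoeffOn hab u' n‖ := by
  have hL : 0 < b - a := sub_pos.2 hab
  rcases eq_or_ne n 0 with rfl | hn
  · have h0 : fourierCoeffOn hab u 0 = 0 := by simp [fourierCoeffOn_eq_integral, hmean]
    rw [h0, norm_zero]
    positivity
  · have hn1 : (1 : ℝ) ≤ |(n : ℝ)| := by exact_mod_cast Int.one_le_abs hn
    have hcoeff : ‖fourierCoeffOn hab u n‖ =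
        (b - a) / (2 * π) / |(n : ℝ)| * ‖fourierCoeffOn hab u' n‖ := by
      rw [fourierCoeffOn_of_hasDerivAt hab hn hu hu', hclosed]
      simp only [sub_self, mul_zero, zero_sub, norm_mul, norm_div, norm_neg]
      rw [← Complex.ofReal_sub, Complex.norm_of_nonneg hL.le]
      simp [abs_of_pos Real.pi_pos]
      ring
    rw [hcoeff]
    exact mul_le_mul_of_nonneg_right (div_le_self (by positivity) hn1) (norm_nonneg _)

theorem wirtinger_inequality {a b : ℝ} (hab : a < b) {u u' : ℝ → ℂ}
    (hu : ∀ x ∈ uIcc a b, HasDerivAt u (u' x) x) (hu' : MemLp u' 2 (volume.restrict (Ioc a b)))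
    (hclosed : u b = u a) (hmean : ∫ x in a..b, u x = 0) :
    ∫ x in a..b, ‖u x‖ ^ 2 ≤ ((b - a) / (2 * π)) ^ 2 * ∫ x in a..b, ‖u' x‖ ^ 2 := by
  have hL : 0 < b - a := sub_pos.2 hab
  have hu_memLp : MemLp u 2 (volume.restrict (Ioc a b)) := by
    have hcont : ContinuousOn u (uIcc a b) := fun x hx =>
      (hu x hx).continuousAt.continuousWithinAt
    rw [uIcc_of_le hab.le] at hcont
    exact memLp_restrict_Ioc_of_continuousOn hcont
  have hu'_int : IntervalIntegrable u' volume a b :=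
    (intervalIntegrable_iff_integrableOn_Ioc_of_le hab.le).2 (hu'.integrable one_le_two)
  have hparseval := hasSum_le (fun n => ?_) (hasSum_sq_fourierCoeffOn hab hu_memLp)
    ((hasSum_sq_fourierCoeffOn hab hu').mul_left (((b - a) / (2 * π)) ^ 2))
  · rw [smul_eq_mul, smul_eq_mul, mul_left_comm] at hparseval
    exact le_of_mul_le_mul_left hparseval (inv_pos.2 hL)
  · rw [← mul_pow]
    gcongr
    exact norm_fourierCoeffOn_le_of_hasDerivAt hab hu hu'_int hclosed hmean n

theorem integral_im_conj_sub_const_mul {a b : ℝ} {G G' : ℝ → ℂ}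
    (hG : ∀ x ∈ uIcc a b, HasDerivAt G (G' x) x) (hG' : ContinuousOn G' (uIcc a b))
    (hclosed : G b = G a) (c : ℂ) :
    ∫ x in a..b, (conj (G x - c) * G' x).im = ∫ x in a..b, (conj (G x) * G' x).im := by
  have hGc : ContinuousOn G (uIcc a b) := fun x hx => (hG x hx).continuousAt.continuousWithinAt
  have hint : ∀ w : ℂ, IntervalIntegrable (fun x => conj (G x - w) * G' x) volume a b := fun w =>
    ((Complex.continuous_conj.comp_continuousOn (hGc.sub continuousOn_const)).mul
      hG').intervalIntegrable
  have him : ∀ w : ℂ, ∫ x in a..b, (conj (G x - w) * G' x).im =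
      (∫ x in a..b, conj (G x - w) * G' x).im := fun w =>
    Complex.imCLM.intervalIntegral_comp_comm (hint w)
  have hG'_zero : ∫ x in a..b, G' x = 0 := by
    rw [intervalIntegral.integral_eq_sub_of_hasDerivAt hG hG'.intervalIntegrable, hclosed, sub_self]
  have hsplit : ∫ x in a..b, conj (G x - c) * G' x = ∫ x in a..b, conj (G x - 0) * G' x := by
    rw [← sub_eq_zero, ← intervalIntegral.integral_sub (hint c) (hint 0)]
    simp_rw [map_sub, map_zero, sub_zero, ← sub_mul, sub_sub_cancel_left]
    rw [intervalIntegral.integral_const_mul, hG'_zero, mul_zero]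
  rw [him, hsplit, ← him]
  simp only [sub_zero]

theorem integral_im_conj_mul_le_integral_norm_sq {a b : ℝ} (hab : a < b) {G G' : ℝ → ℂ}
    (hG : ∀ x, HasDerivAt G (G' x) x) (hG' : Continuous G') (hclosed : G b = G a) :
    ∫ x in a..b, (conj (G x) * G' x).im ≤ (b - a) / (2 * π) * ∫ x in a..b, ‖G' x‖ ^ 2 := by
  have hL : 0 < b - a := sub_pos.2 hab
  have hGc : Continuous G := continuous_iff_continuousAt.2 fun x => (hG x).continuousAt
  set c : ℂ := (b - a)⁻¹ • ∫ x in a..b, G x with hc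
  have hmean : ∫ x in a..b, (G x - c) = 0 := by
    rw [intervalIntegral.integral_sub (hGc.intervalIntegrable _ _) (by simp),
      intervalIntegral.integral_const, hc, smul_inv_smul₀ hL.ne', sub_self]
  have hwirtinger : ∫ x in a..b, ‖G x - c‖ ^ 2 ≤
      ((b - a) / (2 * π)) ^ 2 * ∫ x in a..b, ‖G' x‖ ^ 2 :=
    wirtinger_inequality hab (fun x _ => (hG x).sub_const c)
      (memLp_restrict_Ioc_of_continuousOn hG'.continuousOn) (by rw [hclosed]) hmean
  have hamgm : ∀ x, (conj (G x - c) * G' x).im ≤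
      π / (b - a) * ‖G x - c‖ ^ 2 + (b - a) / (4 * π) * ‖G' x‖ ^ 2 := by
    intro x
    have hsq : π / (b - a) * ‖G x - c‖ ^ 2 + (b - a) / (4 * π) * ‖G' x‖ ^ 2 - ‖G x - c‖ * ‖G' x‖ =
        (2 * π * ‖G x - c‖ - (b - a) * ‖G' x‖) ^ 2 / (4 * π * (b - a)) := by
      field_simp
      ring
    calc (conj (G x - c) * G' x).im ≤ ‖G x - c‖ * ‖G' x‖ := by
          simpa only [norm_mul, RCLike.norm_conj] using Complex.im_le_norm (conj (G x - c) * G' x)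
      _ ≤ _ := by rw [← sub_nonneg, hsq]; positivity
  calc ∫ x in a..b, (conj (G x) * G' x).im
      = ∫ x in a..b, (conj (G x - c) * G' x).im :=
        (integral_im_conj_sub_const_mul (fun x _ => hG x) hG'.continuousOn hclosed c).symm
    _ ≤ ∫ x in a..b, (π / (b - a) * ‖G x - c‖ ^ 2 + (b - a) / (4 * π) * ‖G' x‖ ^ 2) :=
        intervalIntegral.integral_mono_on hab.le (Continuous.intervalIntegrable (by fun_prop) _ _)
          (Continuous.intervalIntegrable (by fun_prop) _ _) fun x _ => hamgm x
    _ = π / (b - a) * (∫ x in a..b, ‖G x - c‖ ^ 2) +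
          (b - a) / (4 * π) * ∫ x in a..b, ‖G' x‖ ^ 2 := by
        rw [intervalIntegral.integral_add (Continuous.intervalIntegrable (by fun_prop) _ _)
          (Continuous.intervalIntegrable (by fun_prop) _ _), intervalIntegral.integral_const_mul,
          intervalIntegral.integral_const_mul]
    _ ≤ π / (b - a) * (((b - a) / (2 * π)) ^ 2 * ∫ x in a..b, ‖G' x‖ ^ 2) +
          (b - a) / (4 * π) * ∫ x in a..b, ‖G' x‖ ^ 2 := by gcongr
    _ = (b - a) / (2 * π) * ∫ x in a..b, ‖G' x‖ ^ 2 := by field_simp; ring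

theorem exists_leftInverse_of_deriv_ge {s v : ℝ → ℝ} {ε : ℝ} (hε : 0 < ε)
    (hs : ∀ x, HasDerivAt s (v x) x) (hv : ∀ x, ε ≤ v x) :
    ∃ ψ : ℝ → ℝ, Function.LeftInverse ψ s ∧ ∀ y, HasDerivAt ψ (v (ψ y))⁻¹ y := by
  have hv_pos : ∀ x, 0 < v x := fun x => hε.trans_le (hv x)
  have hmono : StrictMono s := strictMono_of_hasDerivAt_pos hs hv_pos
  have hs_cont : Continuous s := continuous_iff_continuousAt.2 fun x => (hs x).continuousAt
  have hsub_mono : Monotone fun x => s x - x * ε :=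
    monotone_of_hasDerivAt_nonneg (fun x => (hs x).sub ((hasDerivAt_id x).mul_const ε))
      fun x => by simpa using hv x
  have htop : Tendsto s atTop atTop := by
    refine tendsto_atTop_mono' _ ?_ (tendsto_atTop_add_const_left _ (s 0)
      (tendsto_id.atTop_mul_const hε))
    filter_upwards [eventually_ge_atTop 0] with x hx
    have : s 0 - 0 * ε ≤ s x - x * ε := hsub_mono hx
    simp only [id_eq]
    linarith
  have hbot : Tendsto s atBot atBot := by
    refine tendsto_atBot_mono' _ ?_ (tendsto_atBot_add_const_left _ (s 0)
      (tendsto_id.atBot_mul_const hε))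
    filter_upwards [eventually_le_atBot 0] with x hx
    have : s x - x * ε ≤ s 0 - 0 * ε := hsub_mono hx
    simp only [id_eq]
    linarith
  let e : ℝ ≃o ℝ := hmono.orderIsoOfSurjective s (hs_cont.surjective htop hbot)
  exact ⟨e.symm, e.symm_apply_apply, fun y => HasDerivAt.of_local_left_inverse
    e.symm.continuous.continuousAt (hs _) (hv_pos _).ne' (Eventually.of_forall e.apply_symm_apply)⟩

-- The arc length of `F` need not be invertible, so a positive majorant `v` replaces the speed.
theorem integral_im_conj_mul_le_sq_integral_of_norm_le {a b : ℝ} (hab : a < b) {F F' : ℝ → ℂ}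
    {v : ℝ → ℝ} {ε : ℝ} (hF : ∀ x, HasDerivAt F (F' x) x) (hF' : Continuous F')
    (hclosed : F b = F a) (hv : Continuous v) (hε : 0 < ε) (hv_ge : ∀ x, ε ≤ v x)
    (hF'v : ∀ x, ‖F' x‖ ≤ v x) :
    ∫ x in a..b, (conj (F x) * F' x).im ≤ (∫ x in a..b, v x) ^ 2 / (2 * π) := by
  have hv_pos : ∀ x, 0 < v x := fun x => hε.trans_le (hv_ge x)
  let s : ℝ → ℝ := fun x => ∫ t in a..x, v t
  have hs : ∀ x, HasDerivAt s (v x) x := fun x =>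
    intervalIntegral.integral_hasDerivAt_right (hv.intervalIntegrable _ _)
      (hv.stronglyMeasurableAtFilter _ _) hv.continuousAt
  obtain ⟨ψ, hψs, hψ⟩ := exists_leftInverse_of_deriv_ge hε hs hv_ge
  have hψ_cont : Continuous ψ := continuous_iff_continuousAt.2 fun y => (hψ y).continuousAt
  have hsa : s a = 0 := intervalIntegral.integral_same
  have hsb : 0 < s b := hsa ▸ strictMono_of_hasDerivAt_pos hs hv_pos hab
  let G' : ℝ → ℂ := fun y => (v (ψ y))⁻¹ • F' (ψ y)
  have hG : ∀ y, HasDerivAt (F ∘ ψ) (G' y) y := fun y => (hF (ψ y)).scomp y (hψ y)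
  have hG' : Continuous G' :=
    ((hv.comp hψ_cont).inv₀ fun _ => (hv_pos _).ne').smul (hF'.comp hψ_cont)
  have hG'_le : ∀ y, ‖G' y‖ ^ 2 ≤ 1 := by
    intro y
    rw [norm_smul, norm_inv, Real.norm_of_nonneg (hv_pos _).le, inv_mul_eq_div]
    exact pow_le_one₀ (by have := hv_pos (ψ y); positivity)
      ((div_le_one (hv_pos _)).2 (hF'v _))
  have hF_cont : Continuous F := continuous_iff_continuousAt.2 fun x => (hF x).continuousAt
  calc ∫ x in a..b, (conj (F x) * F' x).im
      = ∫ x in a..b, ((fun y => (conj (F (ψ y)) * G' y).im) ∘ s) x * v x := by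
        congr 1 with x
        simp only [Function.comp_apply, hψs x, G', mul_smul_comm, Complex.smul_im, smul_eq_mul]
        field_simp [(hv_pos x).ne']
    _ = ∫ y in s a..s b, (conj (F (ψ y)) * G' y).im :=
        intervalIntegral.integral_comp_mul_deriv (fun x _ => hs x) hv.continuousOn (by fun_prop)
    _ = ∫ y in 0..s b, (conj (F (ψ y)) * G' y).im := by rw [hsa]
    _ ≤ (s b - 0) / (2 * π) * ∫ y in 0..s b, ‖G' y‖ ^ 2 :=
        integral_im_conj_mul_le_integral_norm_sq hsb hG hG' <| by
          rw [← hsa, hψs, hψs, hclosed]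
    _ ≤ (s b - 0) / (2 * π) * ∫ _ in 0..s b, (1 : ℝ) := by
        gcongr
        exact intervalIntegral.integral_mono_on hsb.le
          (Continuous.intervalIntegrable (by fun_prop) _ _) (by simp) fun y _ => hG'_le y
    _ = s b ^ 2 / (2 * π) := by simp; ring

theorem isoperimetric_inequality {a b : ℝ} (hab : a < b) {F F' : ℝ → ℂ}
    (hF : ∀ x, HasDerivAt F (F' x) x) (hF' : Continuous F') (hclosed : F b = F a) :
    ∫ x in a..b, (conj (F x) * F' x).im ≤ (∫ x in a..b, ‖F' x‖) ^ 2 / (2 * π) := by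
  have hlim : Tendsto (fun ε : ℝ => ((∫ x in a..b, ‖F' x‖) + (b - a) * ε) ^ 2 / (2 * π)) (𝓝[>] 0)
      (𝓝 (((∫ x in a..b, ‖F' x‖) + (b - a) * 0) ^ 2 / (2 * π))) :=
    (Continuous.tendsto (by fun_prop) 0).mono_left nhdsWithin_le_nhds
  rw [mul_zero, add_zero] at hlim
  refine ge_of_tendsto hlim ?_
  filter_upwards [self_mem_nhdsWithin] with ε (hε : 0 < ε)
  have hlength : ∫ x in a..b, (‖F' x‖ + ε) = (∫ x in a..b, ‖F' x‖) + (b - a) * ε := by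
    rw [intervalIntegral.integral_add (hF'.norm.intervalIntegrable _ _) (by simp),
      intervalIntegral.integral_const, smul_eq_mul]
  rw [← hlength]
  exact integral_im_conj_mul_le_sq_integral_of_norm_le hab hF hF' hclosed (by fun_prop) hε
    (fun x => le_add_of_nonneg_left (norm_nonneg _)) fun x => le_add_of_nonneg_right hε.le

end Isoperimetric

section PolarCoordinates

theorem setIntegral_ball_zero_eq_integral_circleMap {E : Type*} [NormedAddCommGroup E]
    [NormedSpace ℝ E] {g : ℂ → E} {R : ℝ} (hR : 0 ≤ R) (hg : ContinuousOn g (closedBall 0 R)) :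
    ∫ z in ball 0 R, g z = ∫ ρ in (0 : ℝ)..R, ρ • ∫ θ in (0 : ℝ)..2 * π, g (circleMap 0 ρ θ) := by
  have hsymm : ∀ p : ℝ × ℝ, Complex.polarCoord.symm p = circleMap 0 p.1 p.2 := fun p => by
    rw [Complex.polarCoord_symm_apply, circleMap_zero, Complex.exp_mul_I, Complex.ofReal_cos,
      Complex.ofReal_sin]
  have htarget : polarCoord.target ∩ {p | p.1 < R} = Ioo 0 R ×ˢ Ioo (-π) π := by
    ext p
    simp only [polarCoord, mem_inter_iff, mem_prod, mem_Ioi, mem_Ioo, mem_ofPred_eq]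
    tauto
  have hindicator : ∀ p ∈ polarCoord.target,
      p.1 • (ball 0 R).indicator g (Complex.polarCoord.symm p) =
        {p : ℝ × ℝ | p.1 < R}.indicator (fun p => p.1 • g (circleMap 0 p.1 p.2)) p := fun p hp => by
    have hp_pos : 0 < p.1 := hp.1
    simp only [indicator, hsymm, mem_ball_zero_iff, norm_circleMap_zero, abs_of_pos hp_pos,
      mem_ofPred_eq]
    split_ifs <;> simp
  have hcont : ContinuousOn (fun p : ℝ × ℝ => p.1 • g (circleMap 0 p.1 p.2))
      (Icc 0 R ×ˢ Icc (-π) π) := by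
    refine continuousOn_fst.smul (hg.comp (by unfold circleMap; fun_prop) fun p hp => ?_)
    rw [mem_closedBall_zero_iff, norm_circleMap_zero, abs_of_nonneg hp.1.1]
    exact hp.1.2
  have hint : IntegrableOn (fun p : ℝ × ℝ => p.1 • g (circleMap 0 p.1 p.2))
      (Ioo 0 R ×ˢ Ioo (-π) π) (volume.prod volume) :=
    (hcont.integrableOn_compact (isCompact_Icc.prod isCompact_Icc)).mono_set
      (prod_mono Ioo_subset_Icc_self Ioo_subset_Icc_self)
  have hperiod : ∀ ρ : ℝ, ∫ θ in Ioo (-π) π, g (circleMap 0 ρ θ) =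
      ∫ θ in (0 : ℝ)..2 * π, g (circleMap 0 ρ θ) := fun ρ => by
    have h := ((periodic_circleMap 0 ρ).comp g).intervalIntegral_add_eq (-π) 0
    rw [zero_add, show -π + 2 * π = π by ring] at h
    exact (integral_Ioc_eq_integral_Ioo.symm.trans
      (intervalIntegral.integral_of_le (by linarith [Real.pi_pos])).symm).trans h
  rw [← integral_indicator measurableSet_ball, ← Complex.integral_comp_polarCoord_symm,
    setIntegral_congr_fun polarCoord.open_target.measurableSet hindicator,
    setIntegral_indicator (measurableSet_lt measurable_fst measurable_const), htarget,
    Measure.volume_eq_prod, setIntegral_prod _ hint, intervalIntegral.integral_of_le hR,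
    integral_Ioc_eq_integral_Ioo]
  simp_rw [integral_smul, hperiod]

theorem setIntegral_ball_eq_integral_circleMap {E : Type*} [NormedAddCommGroup E]
    [NormedSpace ℝ E] {g : ℂ → E} {c : ℂ} {R : ℝ} (hR : 0 ≤ R)
    (hg : ContinuousOn g (closedBall c R)) :
    ∫ z in ball c R, g z = ∫ ρ in (0 : ℝ)..R, ρ • ∫ θ in (0 : ℝ)..2 * π, g (circleMap c ρ θ) := by
  have htranslate : ∫ z in ball c R, g z = ∫ z in ball 0 R, g (c + z) := by
    rw [← (measurePreserving_add_left volume c).setIntegral_preimage_emb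
      (measurableEmbedding_addLeft c), preimage_add_ball, sub_self]
  have hg' : ContinuousOn (fun z => g (c + z)) (closedBall 0 R) :=
    hg.comp (by fun_prop) fun z hz => by simpa using hz
  rw [htranslate, setIntegral_ball_zero_eq_integral_circleMap hR hg']
  simp only [circleMap, zero_add]

theorem setIntegral_ball_eq_pi_mul_sq_smul {E : Type*} [NormedAddCommGroup E] [NormedSpace ℂ E]
    [CompleteSpace E] {p : ℂ → E} {c : ℂ} {s : ℝ} (hs : 0 < s) (hp : DiffContOnCl ℂ p (ball c s)) :
    ∫ z in ball c s, p z = (π * s ^ 2) • p c := by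
  have hmean : ∀ ρ ∈ uIcc 0 s, ρ • ∫ θ in (0 : ℝ)..2 * π, p (circleMap c ρ θ) =
      ρ • ((2 * π) • p c) := by
    intro ρ hρ
    rw [uIcc_of_le hs.le] at hρ
    have havg : Real.circleAverage p c ρ = p c :=
      (hp.mono (ball_subset_ball ((abs_of_nonneg hρ.1).trans_le hρ.2))).circleAverage
    rw [← havg, Real.circleAverage_def, smul_inv_smul₀ Real.two_pi_pos.ne']
  rw [setIntegral_ball_eq_integral_circleMap hs.le hp.continuousOn_ball,
    intervalIntegral.integral_congr hmean, intervalIntegral.integral_smul_const, integral_id,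
    smul_smul]
  congr 1
  ring

end PolarCoordinates

section Green

/-- The pull-back along `P` of the one-form `x dy - y dx`, a primitive of twice the area form. -/
def areaOneForm {E : Type*} [NormedAddCommGroup E] [NormedSpace ℝ E] (P : E → ℂ) (p v : E) : ℝ :=
  (conj (P p) * fderiv ℝ P p v).im

variable {E : Type*} [NormedAddCommGroup E] [NormedSpace ℝ E] {P : E → ℂ} {p : E}

theorem hasFDerivAt_areaOneForm (hP : ContDiffAt ℝ 2 P p) (v : E) :
    HasFDerivAt (fun q => areaOneForm P q v)
      (Complex.imCLM ∘L (conj (P p) • (fderiv ℝ (fderiv ℝ P) p).flip v +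
        fderiv ℝ P p v • (Complex.conjCLE : ℂ →L[ℝ] ℂ) ∘L fderiv ℝ P p)) p := by
  have hDP : DifferentiableAt ℝ (fderiv ℝ P) p :=
    (hP.fderiv_right (m := 1) (by norm_num)).differentiableAt one_ne_zero
  have hDPv : HasFDerivAt (fun q => fderiv ℝ P q v) ((fderiv ℝ (fderiv ℝ P) p).flip v) p := by
    simpa using hDP.hasFDerivAt.clm_apply (hasFDerivAt_const v p)
  exact Complex.imCLM.hasFDerivAt.comp p (((Complex.conjCLE : ℂ →L[ℝ] ℂ).hasFDerivAt.comp p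
    (hP.differentiableAt two_ne_zero).hasFDerivAt).mul hDPv)

theorem fderiv_areaOneForm_sub_fderiv_areaOneForm (hP : ContDiffAt ℝ 2 P p) (v w : E) :
    fderiv ℝ (fun q => areaOneForm P q w) p v - fderiv ℝ (fun q => areaOneForm P q v) p w =
      2 * (conj (fderiv ℝ P p v) * fderiv ℝ P p w).im := by
  have hsymm : fderiv ℝ (fderiv ℝ P) p v w = fderiv ℝ (fderiv ℝ P) p w v :=
    (hP.isSymmSndFDerivAt (by simp)).eq v w
  rw [(hasFDerivAt_areaOneForm hP w).fderiv, (hasFDerivAt_areaOneForm hP v).fderiv]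
  simp [hsymm]
  ring

theorem continuousAt_fderiv_apply (hP : ContDiffAt ℝ 2 P p) (v : E) :
    ContinuousAt (fun q => fderiv ℝ P q v) p :=
  (hP.continuousAt_fderiv two_ne_zero).clm_apply continuousAt_const

theorem integral_integral_im_conj_fderiv_mul_fderiv {P : ℝ × ℝ → ℂ} {a₁ b₁ a₂ b₂ : ℝ}
    (hP : ∀ p ∈ uIcc a₁ b₁ ×ˢ uIcc a₂ b₂, ContDiffAt ℝ 2 P p) :
    ∫ x in a₁..b₁, ∫ y in a₂..b₂, 2 * (conj (fderiv ℝ P (x, y) (1, 0)) *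
        fderiv ℝ P (x, y) (0, 1)).im =
      (∫ x in a₁..b₁, areaOneForm P (x, a₂) (1, 0)) -
        (∫ x in a₁..b₁, areaOneForm P (x, b₂) (1, 0)) +
        (∫ y in a₂..b₂, areaOneForm P (b₁, y) (0, 1)) -
        ∫ y in a₂..b₂, areaOneForm P (a₁, y) (0, 1) := by
  have hderiv : ∀ v, ∀ p ∈ uIcc a₁ b₁ ×ˢ uIcc a₂ b₂, HasFDerivAt (fun q => areaOneForm P q v)
      (fderiv ℝ (fun q => areaOneForm P q v) p) p := fun v p hp =>
    (hasFDerivAt_areaOneForm (hP p hp) v).differentiableAt.hasFDerivAt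
  have hcont : ∀ v, ContinuousOn (fun q => areaOneForm P q v) (uIcc a₁ b₁ ×ˢ uIcc a₂ b₂) :=
    fun v p hp => (hderiv v p hp).continuousAt.continuousWithinAt
  have hrot : ∀ p ∈ uIcc a₁ b₁ ×ˢ uIcc a₂ b₂,
      2 * (conj (fderiv ℝ P p (1, 0)) * fderiv ℝ P p (0, 1)).im =
      fderiv ℝ (fun q => areaOneForm P q (0, 1)) p (1, 0) +
        (-fderiv ℝ (fun q => areaOneForm P q (1, 0)) p) (0, 1) := fun p hp => by
    rw [neg_apply, ← sub_eq_add_neg, fderiv_areaOneForm_sub_fderiv_areaOneForm (hP p hp)]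
  have hsub : Ioo (min a₁ b₁) (max a₁ b₁) ×ˢ Ioo (min a₂ b₂) (max a₂ b₂) ⊆
      uIcc a₁ b₁ ×ˢ uIcc a₂ b₂ := prod_mono Ioo_subset_Icc_self Ioo_subset_Icc_self
  have hint : IntegrableOn (fun p => fderiv ℝ (fun q => areaOneForm P q (0, 1)) p (1, 0) +
      (-fderiv ℝ (fun q => areaOneForm P q (1, 0)) p) (0, 1)) (uIcc a₁ b₁ ×ˢ uIcc a₂ b₂) := by
    refine (ContinuousOn.integrableOn_compact (isCompact_uIcc.prod isCompact_uIcc)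
      fun p hp => ?_).congr_fun hrot (measurableSet_uIcc.prod measurableSet_uIcc)
    have hx := continuousAt_fderiv_apply (hP p hp) (1, 0)
    have hy := continuousAt_fderiv_apply (hP p hp) (0, 1)
    exact ContinuousAt.continuousWithinAt (by fun_prop)
  rw [intervalIntegral.integral_congr fun x hx =>
      intervalIntegral.integral_congr fun y hy => hrot (x, y) ⟨hx, hy⟩,
    integral2_divergence_prod_of_hasFDerivAt _ (fun q => -areaOneForm P q (1, 0)) _ _ a₁ a₂ b₁ b₂
      (hcont (0, 1)) (hcont (1, 0)).neg (fun p hp => hderiv _ p (hsub hp))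
      (fun p hp => (hderiv _ p (hsub hp)).neg) hint]
  simp only [intervalIntegral.integral_neg]
  ring

theorem fderiv_eq_dz_mul_add_dzbar_mul_conj (f : ℂ → ℂ) (z v : ℂ) :
    fderiv ℝ f z v = dz f z * v + dzbar f z * conj v := by
  have hv : fderiv ℝ f z v = v.re * fderiv ℝ f z 1 + v.im * fderiv ℝ f z I := by
    conv_lhs => rw [show v = v.re • (1 : ℂ) + v.im • I by simp]
    rw [map_add, map_smul, map_smul, Complex.real_smul, Complex.real_smul]
  rw [hv, dz, dzbar, Complex.re_eq_add_conj, Complex.im_eq_sub_conj]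
  field_simp
  linear_combination (fderiv ℝ f z I * (v - conj v)) * Complex.I_sq

theorem im_conj_fderiv_mul_fderiv (f : ℂ → ℂ) (z u v : ℂ) :
    (conj (fderiv ℝ f z u) * fderiv ℝ f z v).im = jacobian f z * (conj u * v).im := by
  simp only [fderiv_eq_dz_mul_add_dzbar_mul_conj, jacobian, ← Complex.normSq_eq_norm_sq,
    Complex.normSq_apply, Complex.mul_im, Complex.mul_re, Complex.add_re, Complex.add_im,
    Complex.conj_re, Complex.conj_im]
  ring

theorem hasFDerivAt_circleMap (c : ℂ) (p : ℝ × ℝ) :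
    HasFDerivAt (fun q : ℝ × ℝ => circleMap c q.1 q.2)
      (p.1 • (ContinuousLinearMap.snd ℝ ℝ ℝ).smulRight (circleMap 0 1 p.2 * I) +
        (ContinuousLinearMap.fst ℝ ℝ ℝ).smulRight (circleMap 0 1 p.2)) p := by
  have hangle : HasFDerivAt (fun q : ℝ × ℝ => circleMap 0 1 q.2)
      ((ContinuousLinearMap.snd ℝ ℝ ℝ).smulRight (circleMap 0 1 p.2 * I)) p :=
    (hasDerivAt_circleMap 0 1 p.2).hasFDerivAt.comp p hasFDerivAt_snd
  have hpolar : (fun q : ℝ × ℝ => circleMap c q.1 q.2) = fun q => c + q.1 • circleMap 0 1 q.2 := by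
    ext q
    simp [circleMap]
  rw [hpolar]
  exact (hasFDerivAt_fst.smul hangle).const_add c

theorem contDiff_uncurry_circleMap (c : ℂ) {n : WithTop ℕ∞} :
    ContDiff ℝ n fun q : ℝ × ℝ => circleMap c q.1 q.2 := by
  have hofReal : ContDiff ℝ n (fun x : ℝ => (x : ℂ)) := Complex.ofRealCLM.contDiff
  exact contDiff_const.add ((hofReal.comp contDiff_fst).mul
    ((hofReal.comp contDiff_snd).mul contDiff_const).cexp)

theorem fderiv_comp_circleMap {f : ℂ → ℂ} {c : ℂ} {ρ θ : ℝ}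
    (hf : DifferentiableAt ℝ f (circleMap c ρ θ)) (v : ℝ × ℝ) :
    fderiv ℝ (fun q : ℝ × ℝ => f (circleMap c q.1 q.2)) (ρ, θ) v =
      fderiv ℝ f (circleMap c ρ θ) (v.1 • circleMap 0 1 θ + v.2 • (circleMap 0 ρ θ * I)) := by
  have hcomp : fderiv ℝ (fun q : ℝ × ℝ => f (circleMap c q.1 q.2)) (ρ, θ) = _ :=
    (hf.hasFDerivAt.comp (ρ, θ) (hasFDerivAt_circleMap c (ρ, θ))).fderiv
  rw [hcomp, ContinuousLinearMap.comp_apply]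
  congr 1
  simp [circleMap]
  ring

theorem im_conj_fderiv_comp_circleMap {f : ℂ → ℂ} {c : ℂ} {ρ θ : ℝ}
    (hf : DifferentiableAt ℝ f (circleMap c ρ θ)) :
    (conj (fderiv ℝ (fun q : ℝ × ℝ => f (circleMap c q.1 q.2)) (ρ, θ) (1, 0)) *
      fderiv ℝ (fun q : ℝ × ℝ => f (circleMap c q.1 q.2)) (ρ, θ) (0, 1)).im =
      jacobian f (circleMap c ρ θ) * ρ := by
  have hvol : (conj (circleMap 0 1 θ) * (circleMap 0 ρ θ * I)).im = ρ := by
    rw [conj_circleMap_zero, ← mul_assoc, circleMap_zero_mul, neg_add_cancel, one_mul]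
    simp [circleMap]
  rw [fderiv_comp_circleMap hf, fderiv_comp_circleMap hf, im_conj_fderiv_mul_fderiv]
  simp only [one_smul, zero_smul, add_zero, zero_add, hvol]

theorem areaOneForm_comp_circleMap {f : ℂ → ℂ} {c : ℂ} {ρ θ : ℝ}
    (hf : DifferentiableAt ℝ f (circleMap c ρ θ)) (v : ℝ × ℝ) :
    areaOneForm (fun q : ℝ × ℝ => f (circleMap c q.1 q.2)) (ρ, θ) v =
      areaOneForm f (circleMap c ρ θ) (v.1 • circleMap 0 1 θ + v.2 • (circleMap 0 ρ θ * I)) := by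
  rw [areaOneForm, areaOneForm, fderiv_comp_circleMap hf]

theorem two_mul_setIntegral_jacobian {f : ℂ → ℂ} {c : ℂ} {r : ℝ} (hr : 0 ≤ r)
    (hf : ∀ z ∈ closedBall c r, ContDiffAt ℝ 2 f z) :
    2 * ∫ z in ball c r, jacobian f z =
      ∫ θ in (0 : ℝ)..2 * π, areaOneForm f (circleMap c r θ) (circleMap 0 r θ * I) := by
  have hmem : ∀ ρ ∈ uIcc 0 r, ∀ θ, circleMap c ρ θ ∈ closedBall c r := fun ρ hρ θ => by
    rw [uIcc_of_le hr] at hρ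
    exact closedBall_subset_closedBall hρ.2 (circleMap_mem_closedBall c hρ.1 θ)
  have hdiff : ∀ ρ ∈ uIcc 0 r, ∀ θ, DifferentiableAt ℝ f (circleMap c ρ θ) := fun ρ hρ θ =>
    (hf _ (hmem ρ hρ θ)).differentiableAt two_ne_zero
  have hjacobian : ContinuousOn (jacobian f) (closedBall c r) := fun z hz => by
    have h1 := continuousAt_fderiv_apply (hf z hz) 1
    have hI := continuousAt_fderiv_apply (hf z hz) I
    exact ContinuousAt.continuousWithinAt (by unfold jacobian dz dzbar; fun_prop)
  have hgreen := integral_integral_im_conj_fderiv_mul_fderiv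
    (P := fun q : ℝ × ℝ => f (circleMap c q.1 q.2)) (a₁ := 0) (b₁ := r) (a₂ := 0) (b₂ := 2 * π)
    fun p hp => (hf _ (hmem p.1 hp.1 p.2)).comp p (contDiff_uncurry_circleMap c).contDiffAt
  have hsides : ∫ ρ in (0 : ℝ)..r, areaOneForm (fun q : ℝ × ℝ => f (circleMap c q.1 q.2))
      (ρ, 0) (1, 0) = ∫ ρ in (0 : ℝ)..r,
        areaOneForm (fun q : ℝ × ℝ => f (circleMap c q.1 q.2)) (ρ, 2 * π) (1, 0) :=
    intervalIntegral.integral_congr fun ρ hρ => by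
      simp only [areaOneForm_comp_circleMap (hdiff ρ hρ _), (periodic_circleMap _ _).eq]
  rw [hsides, sub_self, zero_add] at hgreen
  simp only [areaOneForm_comp_circleMap (hdiff r right_mem_uIcc _),
    areaOneForm_comp_circleMap (hdiff 0 left_mem_uIcc _), zero_smul, one_smul, zero_add] at hgreen
  calc 2 * ∫ z in ball c r, jacobian f z
      = ∫ ρ in (0 : ℝ)..r, ∫ θ in (0 : ℝ)..2 * π, 2 * (jacobian f (circleMap c ρ θ) * ρ) := by
        simp only [setIntegral_ball_eq_integral_circleMap hr hjacobian,
          intervalIntegral.integral_const_mul, smul_eq_mul, mul_comm]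
    _ = _ := intervalIntegral.integral_congr fun ρ hρ =>
        intervalIntegral.integral_congr fun θ _ => by
          simp only [im_conj_fderiv_comp_circleMap (hdiff ρ hρ θ)]
    _ = _ := hgreen
    _ = _ := by simp [areaOneForm]

end Green

section WirtingerDerivatives

theorem norm_fderiv_apply_le (f : ℂ → ℂ) (z v : ℂ) :
    ‖fderiv ℝ f z v‖ ≤ bigLambda f z * ‖v‖ := by
  rw [fderiv_eq_dz_mul_add_dzbar_mul_conj, bigLambda, add_mul]
  exact norm_add_le_of_le (norm_mul_le _ _) (by simp)

theorem le_norm_fderiv_apply (f : ℂ → ℂ) (z v : ℂ) :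
    (‖dz f z‖ - ‖dzbar f z‖) * ‖v‖ ≤ ‖fderiv ℝ f z v‖ := by
  rw [fderiv_eq_dz_mul_add_dzbar_mul_conj, sub_mul]
  simpa using norm_sub_le_norm_add (dz f z * v) (dzbar f z * conj v)

theorem norm_dz_add_mul_conj_dzbar_le (f : ℂ → ℂ) (z : ℂ) {c : ℂ} (hc : ‖c‖ = 1) :
    ‖dz f z + c * conj (dzbar f z)‖ ≤ bigLambda f z :=
  norm_add_le_of_le le_rfl (by simp [hc])

theorem exists_norm_eq_one_norm_add_mul (x y : ℂ) :
    ∃ c : ℂ, ‖c‖ = 1 ∧ ‖x + c * y‖ = ‖x‖ + ‖y‖ := by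
  obtain ⟨u, hu, hux⟩ := Complex.exists_norm_mul_eq_self x
  obtain ⟨v, hv, hvy⟩ := Complex.exists_norm_eq_mul_self y
  refine ⟨u * v, by simp [hu, hv], ?_⟩
  calc ‖x + u * v * y‖ = ‖u * ((‖x‖ + ‖y‖ : ℝ) : ℂ)‖ := by
        rw [mul_assoc, ← hvy, Complex.ofReal_add, mul_add, hux]
    _ = ‖x‖ + ‖y‖ := by rw [norm_mul, hu, one_mul, Complex.norm_of_nonneg (by positivity)]

theorem dz_eq_deriv_and_dzbar_eq_conj_deriv {f h g : ℂ → ℂ} {z : ℂ} (hh : DifferentiableAt ℂ h z)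
    (hg : DifferentiableAt ℂ g z) (hf : f =ᶠ[𝓝 z] fun w => h w + conj (g w)) :
    dz f z = deriv h z ∧ dzbar f z = conj (deriv g z) := by
  have hconj := Complex.conjCLE.toContinuousLinearMap.hasFDerivAt.comp z
    (hg.hasDerivAt.hasFDerivAt.restrictScalars ℝ)
  have hfderiv : ∀ v, fderiv ℝ f z v = deriv h z * v + conj (deriv g z) * conj v := fun v => by
    rw [(((hh.hasDerivAt.hasFDerivAt.restrictScalars ℝ).add hconj).congr_of_eventuallyEq hf).fderiv]
    simp [mul_comm]
  constructor
  · rw [dz, hfderiv, hfderiv, map_one, Complex.conj_I]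
    linear_combination (conj (deriv g z) - deriv h z) / 2 * Complex.I_sq
  · rw [dzbar, hfderiv, hfderiv, map_one, Complex.conj_I]
    linear_combination (deriv h z - conj (deriv g z)) / 2 * Complex.I_sq

end WirtingerDerivatives

section Harmonic

variable {f : ℂ → ℂ} {z : ℂ} {r s : ℝ}

theorem mem_unitDisk : z ∈ unitDisk ↔ ‖z‖ < 1 := mem_ball_zero_iff

theorem isOpen_unitDisk : IsOpen unitDisk := isOpen_ball

theorem closedBall_zero_subset_unitDisk (hr : r < 1) : closedBall 0 r ⊆ unitDisk :=
  closedBall_subset_ball hr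

theorem circleMap_zero_mem_unitDisk (hr₀ : 0 ≤ r) (hr₁ : r < 1) (θ : ℝ) :
    circleMap 0 r θ ∈ unitDisk :=
  closedBall_zero_subset_unitDisk hr₁ (circleMap_mem_closedBall 0 hr₀ θ)

namespace IsHarmonicMapping

theorem exists_eqOn_add_conj (hf : IsHarmonicMapping f) :
    ∃ h g : ℂ → ℂ, DifferentiableOn ℂ h unitDisk ∧ DifferentiableOn ℂ g unitDisk ∧
      EqOn f (fun z => h z + conj (g z)) unitDisk := by
  obtain ⟨F, hF, hFre⟩ := hf.1.exists_analyticOnNhd_ball_re_eq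
  obtain ⟨G, hG, hGre⟩ := hf.2.exists_analyticOnNhd_ball_re_eq
  refine ⟨fun z => (F z + I * G z) / 2, fun z => (F z - I * G z) / 2,
    (hF.differentiableOn.add (hG.differentiableOn.const_mul I)).div_const 2,
    (hF.differentiableOn.sub (hG.differentiableOn.const_mul I)).div_const 2, fun z hz => ?_⟩
  have hre : (F z).re = (f z).re := hFre hz
  have him : (G z).re = (f z).im := hGre hz
  rw [← Complex.re_add_im (f z), ← hre, ← him, Complex.re_eq_add_conj, Complex.re_eq_add_conj]
  simp only [map_div₀, map_sub, map_mul, Complex.conj_I, map_ofNat]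
  ring

theorem contDiffAt (hf : IsHarmonicMapping f) (hz : z ∈ unitDisk) : ContDiffAt ℝ 2 f z := by
  have hre := Complex.ofRealCLM.contDiff.contDiffAt.comp z (hf.1 z hz).1
  have him := Complex.ofRealCLM.contDiff.contDiffAt.comp z (hf.2 z hz).1
  exact (hre.add (him.mul (contDiffAt_const (c := I)))).congr_of_eventuallyEq
    (.of_forall fun w => (Complex.re_add_im _).symm)

theorem differentiableAt (hf : IsHarmonicMapping f) (hz : z ∈ unitDisk) :
    DifferentiableAt ℝ f z :=
  (hf.contDiffAt hz).differentiableAt two_ne_zero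

theorem differentiableOn_dz_and_conj_dzbar (hf : IsHarmonicMapping f) :
    DifferentiableOn ℂ (dz f) unitDisk ∧
      DifferentiableOn ℂ (fun z => conj (dzbar f z)) unitDisk := by
  obtain ⟨h, g, hh, hg, hfhg⟩ := hf.exists_eqOn_add_conj
  have hderiv : ∀ z ∈ unitDisk, dz f z = deriv h z ∧ dzbar f z = conj (deriv g z) := fun z hz =>
    have hnhds := isOpen_unitDisk.mem_nhds hz
    dz_eq_deriv_and_dzbar_eq_conj_deriv (hh.differentiableAt hnhds) (hg.differentiableAt hnhds)
      (hfhg.eventuallyEq_of_mem hnhds)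
  exact ⟨(hh.deriv isOpen_unitDisk).congr fun z hz => (hderiv z hz).1,
    (hg.deriv isOpen_unitDisk).congr fun z hz => by rw [(hderiv z hz).2, Complex.conj_conj]⟩

theorem continuousOn_dz (hf : IsHarmonicMapping f) : ContinuousOn (dz f) unitDisk :=
  hf.differentiableOn_dz_and_conj_dzbar.1.continuousOn

theorem continuousOn_dzbar (hf : IsHarmonicMapping f) : ContinuousOn (dzbar f) unitDisk :=
  (Complex.continuous_conj.comp_continuousOn
    hf.differentiableOn_dz_and_conj_dzbar.2.continuousOn).congr fun z _ => by simp

theorem continuousOn_bigLambda (hf : IsHarmonicMapping f) : ContinuousOn (bigLambda f) unitDisk :=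
  hf.continuousOn_dz.norm.add hf.continuousOn_dzbar.norm

theorem continuousOn_jacobian (hf : IsHarmonicMapping f) : ContinuousOn (jacobian f) unitDisk :=
  (hf.continuousOn_dz.norm.pow 2).sub (hf.continuousOn_dzbar.norm.pow 2)

theorem integrableOn_bigLambda_sq (hf : IsHarmonicMapping f) (hsub : closedBall z s ⊆ unitDisk) :
    IntegrableOn (fun w => bigLambda f w ^ 2) (ball z s) :=
  (((hf.continuousOn_bigLambda.pow 2).mono hsub).integrableOn_compact
    (isCompact_closedBall z s)).mono_set ball_subset_closedBall

theorem pi_mul_sq_mul_bigLambda_sq_le (hf : IsHarmonicMapping f) (hs : 0 < s)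
    (hsub : closedBall z s ⊆ unitDisk) :
    π * s ^ 2 * bigLambda f z ^ 2 ≤ ∫ w in ball z s, bigLambda f w ^ 2 := by
  obtain ⟨c, hc, hcz⟩ := exists_norm_eq_one_norm_add_mul (dz f z) (conj (dzbar f z))
  set q : ℂ → ℂ := fun w => dz f w + c * conj (dzbar f w)
  have hq : DifferentiableOn ℂ (fun w => q w ^ 2) unitDisk :=
    (hf.differentiableOn_dz_and_conj_dzbar.1.add
      (hf.differentiableOn_dz_and_conj_dzbar.2.const_mul c)).pow 2
  have hqz : ‖q z‖ = bigLambda f z := by rw [hcz, RCLike.norm_conj, bigLambda]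
  calc π * s ^ 2 * bigLambda f z ^ 2 = ‖∫ w in ball z s, q w ^ 2‖ := by
        rw [setIntegral_ball_eq_pi_mul_sq_smul hs (hq.diffContOnCl_ball hsub), norm_smul, norm_pow,
          hqz, Real.norm_of_nonneg (by positivity)]
    _ ≤ ∫ w in ball z s, bigLambda f w ^ 2 :=
        norm_integral_le_of_norm_le (hf.integrableOn_bigLambda_sq hsub) (.of_forall fun w => by
          rw [norm_pow]
          gcongr
          exact norm_dz_add_mul_conj_dzbar_le f w hc)

end IsHarmonicMapping

theorem circleLength_eq_integral_norm_fderiv (f : ℂ → ℂ) (hr : 0 ≤ r) :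
    circleLength f r =
      ∫ θ in (0 : ℝ)..2 * π, ‖fderiv ℝ f (circleMap 0 r θ) (circleMap 0 r θ * I)‖ := by
  rw [circleLength, ← intervalIntegral.integral_const_mul]
  refine intervalIntegral.integral_congr fun θ _ => ?_
  have hconj : conj (circleMap 0 r θ) = circleMap 0 r θ * Complex.exp (-2 * θ * I) := by
    rw [conj_circleMap_zero, circleMap_zero, circleMap_zero, mul_assoc, ← Complex.exp_add]
    push_cast
    ring_nf
  have htangent : fderiv ℝ f (circleMap 0 r θ) (circleMap 0 r θ * I) = I * circleMap 0 r θ *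
      (dz f (circleMap 0 r θ) - Complex.exp (-2 * θ * I) * dzbar f (circleMap 0 r θ)) := by
    rw [fderiv_eq_dz_mul_add_dzbar_mul_conj, map_mul, hconj, Complex.conj_I]
    ring
  simp only [← circleMap_zero r θ, htangent, norm_mul, Complex.norm_I, one_mul,
    norm_circleMap_zero, abs_of_nonneg hr]

theorem circleLength_nonneg (f : ℂ → ℂ) (hr : 0 ≤ r) : 0 ≤ circleLength f r :=
  mul_nonneg hr (intervalIntegral.integral_nonneg Real.two_pi_pos.le fun _ _ => norm_nonneg _)

theorem circleLength_le_toReal_boundaryLength (hb : boundaryLength f < ⊤) (hr : r ∈ Ioo 0 1) :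
    circleLength f r ≤ (boundaryLength f).toReal := by
  rw [← ENNReal.ofReal_le_iff_le_toReal hb.ne]
  exact le_iSup₂ (f := fun r (_ : r ∈ Ioo (0 : ℝ) 1) => ENNReal.ofReal (circleLength f r)) r hr

theorem IsHarmonicMapping.setIntegral_jacobian_le (hf : IsHarmonicMapping f) (hr₀ : 0 ≤ r)
    (hr₁ : r < 1) : ∫ z in ball 0 r, jacobian f z ≤ circleLength f r ^ 2 / (4 * π) := by
  have hmem := circleMap_zero_mem_unitDisk hr₀ hr₁
  have hcurve : ∀ θ, HasDerivAt (fun θ => f (circleMap 0 r θ))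
      (fderiv ℝ f (circleMap 0 r θ) (circleMap 0 r θ * I)) θ := fun θ =>
    (hf.differentiableAt (hmem θ)).hasFDerivAt.comp_hasDerivAt θ (hasDerivAt_circleMap 0 r θ)
  have hvelocity : Continuous fun θ => fderiv ℝ f (circleMap 0 r θ) (circleMap 0 r θ * I) := by
    have hdz := hf.continuousOn_dz.comp_continuous (continuous_circleMap 0 r) hmem
    have hdzbar := hf.continuousOn_dzbar.comp_continuous (continuous_circleMap 0 r) hmem
    simp_rw [fderiv_eq_dz_mul_add_dzbar_mul_conj]
    fun_prop
  have hiso := isoperimetric_inequality Real.two_pi_pos hcurve hvelocity (by simp [circleMap])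
  rw [← circleLength_eq_integral_norm_fderiv f hr₀] at hiso
  have harea := two_mul_setIntegral_jacobian (f := f) hr₀ fun z hz =>
    hf.contDiffAt (closedBall_zero_subset_unitDisk hr₁ hz)
  calc ∫ z in ball 0 r, jacobian f z = (2 * ∫ z in ball 0 r, jacobian f z) / 2 := by ring
    _ ≤ circleLength f r ^ 2 / (2 * π) / 2 := by rw [harea]; gcongr; exact hiso
    _ = circleLength f r ^ 2 / (4 * π) := by ring

end Harmonic

section Quasiregular

/-- A sense-preserving `K`-quasiregular harmonic mapping of the unit disk. The dilatation condition
is written without the absolute value in `smallLambda`, so that it also encodes sense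
preservation. -/
structure IsQuasiregularHarmonic (K : ℝ) (f : ℂ → ℂ) : Prop where
  one_le : 1 ≤ K
  harmonic : IsHarmonicMapping f
  bigLambda_le_mul_sub : ∀ z ∈ unitDisk, bigLambda f z ≤ K * (‖dz f z‖ - ‖dzbar f z‖)

theorem IsQuasiconformalHarmonic.isQuasiregularHarmonic {K : ℝ} {f : ℂ → ℂ}
    (hf : IsQuasiconformalHarmonic K f) : IsQuasiregularHarmonic K f where
  one_le := hf.one_le
  harmonic := hf.harmonic
  bigLambda_le_mul_sub z hz := by
    have hlt : ‖dzbar f z‖ < ‖dz f z‖ :=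
      lt_of_pow_lt_pow_left₀ 2 (norm_nonneg _) (sub_pos.1 (hf.sensePreserving z hz))
    simpa only [smallLambda, abs_of_pos (sub_pos.2 hlt)] using hf.quasiregular z hz

theorem bigLambda_nonneg (f : ℂ → ℂ) (z : ℂ) : 0 ≤ bigLambda f z := by
  unfold bigLambda
  positivity

namespace IsQuasiregularHarmonic

variable {K : ℝ} {f : ℂ → ℂ} {z : ℂ} {r s : ℝ}

theorem constant_nonneg (hf : IsQuasiregularHarmonic K f) : 0 ≤ K := zero_le_one.trans hf.one_le

theorem bigLambda_sq_le (hf : IsQuasiregularHarmonic K f) (hz : z ∈ unitDisk) :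
    bigLambda f z ^ 2 ≤ K * jacobian f z :=
  calc bigLambda f z ^ 2 ≤ K * (‖dz f z‖ - ‖dzbar f z‖) * bigLambda f z := by
        rw [sq]
        exact mul_le_mul_of_nonneg_right (hf.bigLambda_le_mul_sub z hz) (bigLambda_nonneg f z)
    _ = K * jacobian f z := by
        rw [bigLambda, jacobian]
        ring

theorem setIntegral_bigLambda_sq_le (hf : IsQuasiregularHarmonic K f) (hr₀ : 0 ≤ r) (hr₁ : r < 1) :
    ∫ z in ball 0 r, bigLambda f z ^ 2 ≤ K * (circleLength f r ^ 2 / (4 * π)) := by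
  have hdisk := closedBall_zero_subset_unitDisk hr₁
  have hjacobian : IntegrableOn (jacobian f) (ball 0 r) :=
    ((hf.harmonic.continuousOn_jacobian.mono hdisk).integrableOn_compact
      (isCompact_closedBall 0 r)).mono_set ball_subset_closedBall
  calc ∫ z in ball 0 r, bigLambda f z ^ 2 ≤ ∫ z in ball 0 r, K * jacobian f z :=
        setIntegral_mono_on (hf.harmonic.integrableOn_bigLambda_sq hdisk) (hjacobian.const_mul K)
          measurableSet_ball fun z hz => hf.bigLambda_sq_le (hdisk (ball_subset_closedBall hz))
    _ = K * ∫ z in ball 0 r, jacobian f z := integral_const_mul K _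
    _ ≤ K * (circleLength f r ^ 2 / (4 * π)) :=
        mul_le_mul_of_nonneg_left (hf.harmonic.setIntegral_jacobian_le hr₀ hr₁) hf.constant_nonneg

theorem bigLambda_mul_le (hf : IsQuasiregularHarmonic K f) (hs : 0 < s) (hzs : ‖z‖ + s < 1) :
    bigLambda f z * (2 * π * s) ≤ circleLength f (‖z‖ + s) * √K := by
  have hr : 0 ≤ ‖z‖ + s := by positivity
  have hsub : ball z s ⊆ ball 0 (‖z‖ + s) := ball_subset_ball' (by simp [add_comm])
  have hdisk : closedBall z s ⊆ unitDisk := closedBall_subset_ball' (by simpa [add_comm] using hzs)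
  have hsq : π * s ^ 2 * bigLambda f z ^ 2 ≤ K * (circleLength f (‖z‖ + s) ^ 2 / (4 * π)) :=
    calc π * s ^ 2 * bigLambda f z ^ 2 ≤ ∫ w in ball z s, bigLambda f w ^ 2 :=
          hf.harmonic.pi_mul_sq_mul_bigLambda_sq_le hs hdisk
      _ ≤ ∫ w in ball 0 (‖z‖ + s), bigLambda f w ^ 2 :=
          setIntegral_mono_set
            (hf.harmonic.integrableOn_bigLambda_sq (closedBall_zero_subset_unitDisk hzs))
            (.of_forall fun w => sq_nonneg _) (.of_forall hsub)
      _ ≤ K * (circleLength f (‖z‖ + s) ^ 2 / (4 * π)) := hf.setIntegral_bigLambda_sq_le hr hzs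
  refine le_of_sq_le_sq ?_ (mul_nonneg (circleLength_nonneg f hr) (Real.sqrt_nonneg K))
  calc (bigLambda f z * (2 * π * s)) ^ 2 = 4 * π * (π * s ^ 2 * bigLambda f z ^ 2) := by ring
    _ ≤ 4 * π * (K * (circleLength f (‖z‖ + s) ^ 2 / (4 * π))) := by gcongr
    _ = (circleLength f (‖z‖ + s) * √K) ^ 2 := by
        rw [mul_pow, Real.sq_sqrt hf.constant_nonneg]
        field_simp

theorem bigLambda_le (hf : IsQuasiregularHarmonic K f) (hb : boundaryLength f < ⊤)
    (hz : z ∈ unitDisk) :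
    bigLambda f z ≤ (boundaryLength f).toReal * √K / (2 * π * (1 - ‖z‖)) := by
  have hgap : 0 < 1 - ‖z‖ := sub_pos.2 (mem_unitDisk.1 hz)
  have hlim : Tendsto (fun s => bigLambda f z * (2 * π * s)) (𝓝[<] (1 - ‖z‖))
      (𝓝 (bigLambda f z * (2 * π * (1 - ‖z‖)))) :=
    (Continuous.tendsto (by fun_prop) _).mono_left nhdsWithin_le_nhds
  rw [le_div_iff₀ (by positivity)]
  refine le_of_tendsto hlim ?_
  filter_upwards [Ioo_mem_nhdsLT hgap] with s hs
  have hzs : ‖z‖ + s ∈ Ioo 0 1 :=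
    ⟨add_pos_of_nonneg_of_pos (norm_nonneg z) hs.1, by linarith [hs.2]⟩
  exact (hf.bigLambda_mul_le hs.1 hzs.2).trans (mul_le_mul_of_nonneg_right
    (circleLength_le_toReal_boundaryLength hb hzs) (Real.sqrt_nonneg K))

theorem integral_bigLambda_le (hf : IsQuasiregularHarmonic K f) (hr₀ : 0 ≤ r) (hr₁ : r < 1) :
    r * ∫ θ in (0 : ℝ)..2 * π, bigLambda f (circleMap 0 r θ) ≤ K * circleLength f r := by
  have hmem := circleMap_zero_mem_unitDisk hr₀ hr₁
  have hdz := hf.harmonic.continuousOn_dz.comp_continuous (continuous_circleMap 0 r) hmem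
  have hdzbar := hf.harmonic.continuousOn_dzbar.comp_continuous (continuous_circleMap 0 r) hmem
  rw [circleLength_eq_integral_norm_fderiv f hr₀, ← intervalIntegral.integral_const_mul,
    ← intervalIntegral.integral_const_mul]
  refine intervalIntegral.integral_mono Real.two_pi_pos.le
    (Continuous.intervalIntegrable (by unfold bigLambda; fun_prop) _ _)
    (Continuous.intervalIntegrable
      (by simp only [fderiv_eq_dz_mul_add_dzbar_mul_conj]; fun_prop) _ _) fun θ => ?_
  set w := circleMap 0 r θ
  have hnorm : ‖w * I‖ = r := by simp [w, abs_of_nonneg hr₀]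
  calc r * bigLambda f w ≤ r * (K * (‖dz f w‖ - ‖dzbar f w‖)) :=
        mul_le_mul_of_nonneg_left (hf.bigLambda_le_mul_sub w (hmem θ)) hr₀
    _ = K * ((‖dz f w‖ - ‖dzbar f w‖) * ‖w * I‖) := by rw [hnorm]; ring
    _ ≤ K * ‖fderiv ℝ f w (w * I)‖ :=
        mul_le_mul_of_nonneg_left (le_norm_fderiv_apply f w _) hf.constant_nonneg

end IsQuasiregularHarmonic

end Quasiregular

section Hyperbolic

variable {F : Type*} [NormedAddCommGroup F] [NormedSpace ℝ F]

theorem hasDerivAt_artanh {x : ℝ} (hx : x ∈ Ioo (-1) 1) :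
    HasDerivAt Real.artanh (1 - x ^ 2)⁻¹ x := by
  have hadd : 0 < 1 + x := by linarith [hx.1]
  have hsub : 0 < 1 - x := by linarith [hx.2]
  have hlog := ((((hasDerivAt_id x).const_add 1).log hadd.ne').sub
    (((hasDerivAt_id x).const_sub 1).log hsub.ne')).const_mul (1 / 2)
  refine (hlog.congr_deriv ?_).congr_of_eventuallyEq ?_
  · rw [show 1 - x ^ 2 = (1 + x) * (1 - x) by ring, id]
    field_simp
    ring
  · filter_upwards [Ioo_mem_nhds hx.1 hx.2] with y hy
    rw [Real.artanh_eq_half_log (Ioo_subset_Icc_self hy),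
      Real.log_div (by linarith [hy.1]) (by linarith [hy.2])]
    rfl

theorem norm_sub_le_mul_artanh_norm {E : Type*} [NormedAddCommGroup E] [NormedSpace ℝ E] {g : E → F}
    {C : ℝ} (hg : ∀ v ∈ ball 0 1, DifferentiableAt ℝ g v)
    (hC : ∀ v ∈ ball 0 1, ‖fderiv ℝ g v‖ * (1 - ‖v‖ ^ 2) ≤ C) {v : E} (hv : v ∈ ball 0 1) :
    ‖g v - g 0‖ ≤ C * Real.artanh ‖v‖ := by
  rw [mem_ball_zero_iff] at hv
  have hscale : ∀ t ∈ Icc (0 : ℝ) 1, ‖t • v‖ = t * ‖v‖ ∧ t * ‖v‖ < 1 := fun t ht =>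
    ⟨norm_smul_of_nonneg ht.1 v, (mul_le_of_le_one_left (norm_nonneg v) ht.2).trans_lt hv⟩
  have hmem : ∀ t ∈ Icc (0 : ℝ) 1, t • v ∈ ball 0 1 := fun t ht => by
    rw [mem_ball_zero_iff, (hscale t ht).1]
    exact (hscale t ht).2
  have hcurve : ∀ t ∈ Icc (0 : ℝ) 1,
      HasDerivAt (fun t : ℝ => g (t • v) - g 0) (fderiv ℝ g (t • v) v) t := fun t ht => by
    simpa using ((hg _ (hmem t ht)).hasFDerivAt.comp_hasDerivAt t
      ((hasDerivAt_id t).smul_const v)).sub_const (g 0)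
  have hartanh : ∀ t ∈ Icc (0 : ℝ) 1, HasDerivAt (fun t : ℝ => C * Real.artanh (t * ‖v‖))
      (C * ((1 - (t * ‖v‖) ^ 2)⁻¹ * ‖v‖)) t := fun t ht => by
    have hx : t * ‖v‖ ∈ Ioo (-1) 1 :=
      ⟨by linarith [mul_nonneg ht.1 (norm_nonneg v)], (hscale t ht).2⟩
    exact ((hasDerivAt_artanh hx).comp t (hasDerivAt_mul_const ‖v‖)).const_mul C
  have hspeed : ∀ t ∈ Icc (0 : ℝ) 1,
      ‖fderiv ℝ g (t • v) v‖ ≤ C * ((1 - (t * ‖v‖) ^ 2)⁻¹ * ‖v‖) := fun t ht => by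
    have hpos : 0 < 1 - (t * ‖v‖) ^ 2 :=
      sub_pos.2 (pow_lt_one₀ (mul_nonneg ht.1 (norm_nonneg v)) (hscale t ht).2 two_ne_zero)
    have hbound := hC _ (hmem t ht)
    rw [(hscale t ht).1, ← le_div_iff₀ hpos] at hbound
    rw [← mul_assoc, ← div_eq_mul_inv]
    exact (fderiv ℝ g (t • v)).le_of_opNorm_le hbound v
  have hIcc : ∀ {t : ℝ}, t ∈ Ico (0 : ℝ) 1 → t ∈ Icc (0 : ℝ) 1 := fun ht => Ico_subset_Icc_self ht
  simpa using image_norm_le_of_norm_deriv_right_le_deriv_boundary'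
    (fun t ht => (hcurve t ht).continuousAt.continuousWithinAt)
    (fun t ht => (hcurve t (hIcc ht)).hasDerivWithinAt) (by simp)
    (fun t ht => (hartanh t ht).continuousAt.continuousWithinAt)
    (fun t ht => (hartanh t (hIcc ht)).hasDerivWithinAt) (fun t ht => hspeed t (hIcc ht))
    (right_mem_Icc.2 zero_le_one)

/-- The automorphism of the unit disk that moves `0` to `z` along a hyperbolic geodesic. -/
def moebius (z m : ℂ) : ℂ := (z + m) / (1 + conj z * m)

variable {z w m : ℂ}

theorem neg_mem_unitDisk (hz : z ∈ unitDisk) : -z ∈ unitDisk := by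
  rwa [mem_unitDisk, norm_neg, ← mem_unitDisk]

theorem one_sub_norm_sq_pos (hz : z ∈ unitDisk) : 0 < 1 - ‖z‖ ^ 2 :=
  sub_pos.2 (pow_lt_one₀ (norm_nonneg z) (mem_unitDisk.1 hz) two_ne_zero)

theorem one_add_conj_mul_ne_zero (hz : z ∈ unitDisk) (hm : m ∈ unitDisk) :
    1 + conj z * m ≠ 0 := by
  intro h
  have hnorm : ‖z‖ * ‖m‖ = 1 := by
    rw [← RCLike.norm_conj z, ← norm_mul, eq_neg_of_add_eq_zero_right h, norm_neg, norm_one]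
  exact (mul_lt_one_of_nonneg_of_lt_one_left (norm_nonneg z) (mem_unitDisk.1 hz)
    (mem_unitDisk.1 hm).le).ne hnorm

theorem one_sub_norm_sq_moebius (hz : z ∈ unitDisk) (hm : m ∈ unitDisk) :
    1 - ‖moebius z m‖ ^ 2 = (1 - ‖z‖ ^ 2) / ‖1 + conj z * m‖ ^ 2 * (1 - ‖m‖ ^ 2) := by
  have hne : ‖1 + conj z * m‖ ≠ 0 := norm_ne_zero_iff.2 (one_add_conj_mul_ne_zero hz hm)
  have hnum : ‖1 + conj z * m‖ ^ 2 - ‖z + m‖ ^ 2 = (1 - ‖z‖ ^ 2) * (1 - ‖m‖ ^ 2) := by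
    simp only [← Complex.normSq_eq_norm_sq, Complex.normSq_apply, Complex.add_re, Complex.add_im,
      Complex.mul_re, Complex.mul_im, Complex.conj_re, Complex.conj_im, Complex.one_re,
      Complex.one_im]
    ring
  rw [div_mul_eq_mul_div, ← hnum, moebius, norm_div, div_pow, sub_div, div_self (pow_ne_zero 2 hne)]

theorem moebius_mem_unitDisk (hz : z ∈ unitDisk) (hm : m ∈ unitDisk) : moebius z m ∈ unitDisk := by
  have hden : 0 < ‖1 + conj z * m‖ := norm_pos_iff.2 (one_add_conj_mul_ne_zero hz hm)
  have hpos : 0 < 1 - ‖moebius z m‖ ^ 2 := by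
    rw [one_sub_norm_sq_moebius hz hm]
    have hz_pos := one_sub_norm_sq_pos hz
    have hm_pos := one_sub_norm_sq_pos hm
    positivity
  exact mem_unitDisk.2 ((pow_lt_one_iff_of_nonneg (norm_nonneg _) two_ne_zero).1 (sub_pos.1 hpos))

theorem moebius_zero_right (z : ℂ) : moebius z 0 = z := by simp [moebius]

theorem moebius_moebius_neg (hz : z ∈ unitDisk) (hw : w ∈ unitDisk) :
    moebius z (moebius (-z) w) = w := by
  have hne := one_add_conj_mul_ne_zero (neg_mem_unitDisk hz) hw
  rw [moebius, div_eq_iff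
    (one_add_conj_mul_ne_zero hz (moebius_mem_unitDisk (neg_mem_unitDisk hz) hw))]
  rw [map_neg] at hne
  have hmul := div_mul_cancel₀ (-z + w) hne
  rw [moebius, map_neg]
  linear_combination hmul

theorem hasDerivAt_moebius (hz : z ∈ unitDisk) (hm : m ∈ unitDisk) :
    HasDerivAt (moebius z) ((1 - ‖z‖ ^ 2 : ℝ) / (1 + conj z * m) ^ 2) m := by
  refine (((hasDerivAt_id m).const_add z).div (((hasDerivAt_id m).const_mul (conj z)).const_add 1)
    (one_add_conj_mul_ne_zero hz hm)).congr_deriv ?_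
  congr 1
  rw [Complex.ofReal_sub, Complex.ofReal_one, Complex.ofReal_pow, ← Complex.mul_conj', id]
  ring

theorem norm_fderiv_comp_moebius_mul_le {f : ℂ → F} (hz : z ∈ unitDisk) (hm : m ∈ unitDisk)
    (hf : DifferentiableAt ℝ f (moebius z m)) :
    ‖fderiv ℝ (f ∘ moebius z) m‖ * (1 - ‖m‖ ^ 2) ≤
      ‖fderiv ℝ f (moebius z m)‖ * (1 - ‖moebius z m‖ ^ 2) := by
  have hmoebius := (hasDerivAt_moebius hz hm).hasFDerivAt.restrictScalars ℝ
  have hnorm : ‖fderiv ℝ (f ∘ moebius z) m‖ ≤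
      ‖fderiv ℝ f (moebius z m)‖ * ((1 - ‖z‖ ^ 2) / ‖1 + conj z * m‖ ^ 2) := by
    rw [(hf.hasFDerivAt.comp m hmoebius).fderiv]
    refine (ContinuousLinearMap.opNorm_comp_le _ _).trans_eq ?_
    rw [ContinuousLinearMap.norm_restrictScalars, ContinuousLinearMap.norm_toSpanSingleton,
      norm_div, norm_pow, Complex.norm_of_nonneg (one_sub_norm_sq_pos hz).le]
  rw [one_sub_norm_sq_moebius hz hm, ← mul_assoc]
  exact mul_le_mul_of_nonneg_right hnorm (one_sub_norm_sq_pos hm).le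

theorem hypDist_eq_artanh (hz : z ∈ unitDisk) (hw : w ∈ unitDisk) :
    hypDist z w = Real.artanh ‖moebius (-z) w‖ := by
  have hlt := mem_unitDisk.1 (moebius_mem_unitDisk (neg_mem_unitDisk hz) hw)
  have hnorm : ‖(z - w) / (1 - conj z * w)‖ = ‖moebius (-z) w‖ := by
    rw [moebius, map_neg, neg_mul, ← sub_eq_add_neg, neg_add_eq_sub, norm_div, norm_div,
      norm_sub_rev]
  rw [hypDist, hnorm, Real.artanh_eq_half_log ⟨by linarith [norm_nonneg (moebius (-z) w)], hlt.le⟩]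

theorem hypDist_nonneg (hz : z ∈ unitDisk) (hw : w ∈ unitDisk) : 0 ≤ hypDist z w := by
  rw [hypDist_eq_artanh hz hw]
  exact Real.artanh_nonneg (norm_nonneg _)

theorem norm_sub_le_mul_hypDist {f : ℂ → F} {C : ℝ} (hf : ∀ z ∈ unitDisk, DifferentiableAt ℝ f z)
    (hC : ∀ z ∈ unitDisk, ‖fderiv ℝ f z‖ * (1 - ‖z‖ ^ 2) ≤ C) (hz : z ∈ unitDisk)
    (hw : w ∈ unitDisk) : ‖f z - f w‖ ≤ C * hypDist z w := by
  have hradial := norm_sub_le_mul_artanh_norm (g := f ∘ moebius z)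
    (fun m hm => (hf _ (moebius_mem_unitDisk hz hm)).comp m
      ((hasDerivAt_moebius hz hm).differentiableAt.restrictScalars ℝ))
    (fun m hm => (norm_fderiv_comp_moebius_mul_le hz hm (hf _ (moebius_mem_unitDisk hz hm))).trans
      (hC _ (moebius_mem_unitDisk hz hm)))
    (moebius_mem_unitDisk (neg_mem_unitDisk hz) hw)
  rwa [Function.comp_apply, Function.comp_apply, moebius_moebius_neg hz hw, moebius_zero_right,
    ← hypDist_eq_artanh hz hw, norm_sub_rev] at hradial

end Hyperbolic

section Bloch

variable {K : ℝ} {f : ℂ → ℂ}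

theorem IsQuasiregularHarmonic.norm_sub_le_mul_hypDist (hf : IsQuasiregularHarmonic K f)
    (hb : boundaryLength f < ⊤) {z w : ℂ} (hz : z ∈ unitDisk) (hw : w ∈ unitDisk) :
    ‖f z - f w‖ ≤ (boundaryLength f).toReal * √K / π * hypDist z w := by
  refine PlanarHarmonic.norm_sub_le_mul_hypDist (fun _ => hf.harmonic.differentiableAt)
    (fun z hz => ?_) hz hw
  have hgap : 0 < 1 - ‖z‖ := sub_pos.2 (mem_unitDisk.1 hz)
  have hfderiv : ‖fderiv ℝ f z‖ ≤ bigLambda f z :=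
    ContinuousLinearMap.opNorm_le_bound _ (bigLambda_nonneg f z) (norm_fderiv_apply_le f z)
  have hfactor : 1 - ‖z‖ ^ 2 ≤ 2 * (1 - ‖z‖) := by nlinarith [sq_nonneg (1 - ‖z‖)]
  calc ‖fderiv ℝ f z‖ * (1 - ‖z‖ ^ 2)
      ≤ (boundaryLength f).toReal * √K / (2 * π * (1 - ‖z‖)) * (2 * (1 - ‖z‖)) :=
        mul_le_mul (hfderiv.trans (hf.bigLambda_le hb hz)) hfactor (one_sub_norm_sq_pos hz).le
          (by positivity)
    _ = (boundaryLength f).toReal * √K / π := by field_simp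

theorem IsQuasiregularHarmonic.lipschitzNumber_le (hf : IsQuasiregularHarmonic K f)
    (hb : boundaryLength f < ⊤) :
    lipschitzNumber f ≤ ENNReal.ofReal ((boundaryLength f).toReal * √K / π) :=
  iSup₂_le fun _ hz => iSup₂_le fun _ hw => iSup_le fun _ => ENNReal.ofReal_le_ofReal <|
    div_le_of_le_mul₀ (hypDist_nonneg hz hw) (by positivity) (hf.norm_sub_le_mul_hypDist hb hz hw)

theorem IsQuasiregularHarmonic.isHarmonicBloch (hf : IsQuasiregularHarmonic K f)
    (hb : boundaryLength f < ⊤) : IsHarmonicBloch f :=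
  ⟨hf.harmonic, (hf.lipschitzNumber_le hb).trans_lt ENNReal.ofReal_lt_top⟩

end Bloch

section Coefficients

theorem hasFPowerSeriesOnBall_tsum {d : ℕ → ℂ} {R : ℝ≥0∞} (hR : 0 < R)
    (hd : ∀ z ∈ eball 0 R, Summable fun n => d n * z ^ n) :
    HasFPowerSeriesOnBall (fun z => ∑' n, d n * z ^ n)
      (FormalMultilinearSeries.ofScalars ℂ d) 0 R where
  r_le := by
    refine ENNReal.le_of_forall_nnreal_lt fun r hr =>
      FormalMultilinearSeries.le_radius_of_summable_norm _ ?_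
    have hmem : ((r : ℝ) : ℂ) ∈ eball 0 R := by
      rwa [mem_eball, edist_zero_right, enorm_eq_nnnorm, Complex.nnnorm_real, NNReal.nnnorm_eq]
    simpa [FormalMultilinearSeries.ofScalars_norm] using (hd _ hmem).norm
  r_pos := hR
  hasSum hy := by
    simpa [FormalMultilinearSeries.ofScalars_apply_eq, mul_comm] using (hd _ hy).hasSum

theorem coeff_eq_iteratedDeriv_div {q : ℂ → ℂ} {d : ℕ → ℂ} {z : ℂ}
    (hq : HasFPowerSeriesAt q (FormalMultilinearSeries.ofScalars ℂ d) z) (n : ℕ) :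
    d n = iteratedDeriv n q z / n.factorial := by
  have hseries := hq.eq_formalMultilinearSeries hq.analyticAt.hasFPowerSeriesAt
  rw [FormalMultilinearSeries.ofScalars_series_eq_iff] at hseries
  exact congrFun hseries n

theorem mul_norm_coeff_mul_pow_le {q : ℂ → ℂ} {d : ℕ → ℂ} {z : ℂ} {r : ℝ} (hr : 0 < r)
    (hq : HasFPowerSeriesAt q (FormalMultilinearSeries.ofScalars ℂ d) z)
    (hderiv : DifferentiableOn ℂ (deriv q) (closedBall z r)) (n : ℕ) :
    n * ‖d n‖ * r ^ n ≤ (2 * π)⁻¹ * (r * ∫ θ in (0 : ℝ)..2 * π, ‖deriv q (circleMap z r θ)‖) := by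
  cases n with
  | zero =>
    rw [Nat.cast_zero, zero_mul, zero_mul]
    have hint := intervalIntegral.integral_nonneg_of_forall (μ := volume) Real.two_pi_pos.le
      fun θ => norm_nonneg (deriv q (circleMap z r θ))
    positivity
  | succ k =>
    lift r to NNReal using hr.le
    have hseries : cauchyPowerSeries (deriv q) z r = FormalMultilinearSeries.ofScalars ℂ
        fun n => iteratedDeriv n (deriv q) z / n.factorial :=
      (hderiv.hasFPowerSeriesOnBall hr).hasFPowerSeriesAt.eq_formalMultilinearSeries
        (hderiv.analyticAt (closedBall_mem_nhds z hr)).hasFPowerSeriesAt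
    have hcoeff : ‖iteratedDeriv k (deriv q) z / (k.factorial : ℂ)‖ = (k + 1) * ‖d (k + 1)‖ := by
      rw [coeff_eq_iteratedDeriv_div hq, iteratedDeriv_succ', norm_div, norm_div,
        Nat.factorial_succ, Complex.norm_natCast, Complex.norm_natCast]
      push_cast
      field_simp
    have hcauchy := norm_cauchyPowerSeries_le (deriv q) z r k
    rw [hseries, FormalMultilinearSeries.ofScalars_norm, hcoeff, abs_of_pos hr, inv_pow,
      ← div_eq_mul_inv, le_div_iff₀ (by positivity)] at hcauchy
    calc ((k + 1 : ℕ) : ℝ) * ‖d (k + 1)‖ * r ^ (k + 1) = r * ((k + 1) * ‖d (k + 1)‖ * r ^ k) := by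
          push_cast
          ring
      _ ≤ r * ((2 * π)⁻¹ * ∫ θ in (0 : ℝ)..2 * π, ‖deriv q (circleMap z r θ)‖) :=
          mul_le_mul_of_nonneg_left hcauchy hr.le
      _ = _ := mul_left_comm _ _ _

theorem eball_zero_one : eball (0 : ℂ) 1 = unitDisk := by
  rw [unitDisk, ← ENNReal.ofReal_one, eball_ofReal]

variable {f : ℂ → ℂ} {a b : ℕ → ℂ}

theorem HasHarmonicExpansion.exists_hasFPowerSeriesOnBall (hab : HasHarmonicExpansion f a b) :
    ∃ h g : ℂ → ℂ, HasFPowerSeriesOnBall h (FormalMultilinearSeries.ofScalars ℂ a) 0 1 ∧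
      HasFPowerSeriesOnBall g
        (FormalMultilinearSeries.ofScalars ℂ (Function.update b 0 0)) 0 1 ∧
      EqOn f (fun z => h z + conj (g z)) unitDisk := by
  have hsummable : ∀ z ∈ unitDisk, Summable fun n => Function.update b 0 0 n * z ^ n := by
    intro z hz
    rw [← summable_nat_add_iff 1]
    simpa using Complex.conjCLE.toContinuousLinearMap.summable (hab z hz).2.1
  refine ⟨_, _, hasFPowerSeriesOnBall_tsum one_pos fun z hz => (hab z (eball_zero_one ▸ hz)).1,
    hasFPowerSeriesOnBall_tsum one_pos fun z hz => hsummable z (eball_zero_one ▸ hz),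
    fun z hz => ?_⟩
  beta_reduce
  rw [(hab z hz).2.2, (hsummable z hz).tsum_eq_zero_add, map_add, Complex.conj_tsum]
  simp

theorem HasHarmonicExpansion.exists_deriv_eq (hab : HasHarmonicExpansion f a b) (c : ℂ) :
    ∃ q : ℂ → ℂ, HasFPowerSeriesOnBall q
        (FormalMultilinearSeries.ofScalars ℂ (a + c • Function.update b 0 0)) 0 1 ∧
      ∀ z ∈ unitDisk, deriv q z = dz f z + c * conj (dzbar f z) := by
  obtain ⟨h, g, hh, hg, hf⟩ := hab.exists_hasFPowerSeriesOnBall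
  have hq := hh.add (hg.const_smul (c := c))
  rw [← FormalMultilinearSeries.ofScalars_smul, ← FormalMultilinearSeries.ofScalars_add] at hq
  refine ⟨h + c • g, hq, fun z hz => ?_⟩
  have hball : z ∈ eball (0 : ℂ) 1 := eball_zero_one ▸ hz
  have hhz := (hh.analyticAt_of_mem hball).differentiableAt
  have hgz := (hg.analyticAt_of_mem hball).differentiableAt
  obtain ⟨hdz, hdzbar⟩ := dz_eq_deriv_and_dzbar_eq_conj_deriv hhz hgz
    (hf.eventuallyEq_of_mem (isOpen_unitDisk.mem_nhds hz))
  rw [deriv_add hhz (hgz.const_smul c), deriv_const_smul_field, hdz, hdzbar, Complex.conj_conj,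
    smul_eq_mul]

theorem HasHarmonicExpansion.mul_norm_coeff_add_mul_pow_le (hab : HasHarmonicExpansion f a b)
    (hf : IsHarmonicMapping f) {r : ℝ} (hr₀ : 0 < r) (hr₁ : r < 1) {n : ℕ} (hn : n ≠ 0) :
    n * (‖a n‖ + ‖b n‖) * r ^ n ≤
      (2 * π)⁻¹ * (r * ∫ θ in (0 : ℝ)..2 * π, bigLambda f (circleMap 0 r θ)) := by
  obtain ⟨c, hc, hnorm⟩ := exists_norm_eq_one_norm_add_mul (a n) (b n)
  obtain ⟨q, hq, hderiv⟩ := hab.exists_deriv_eq c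
  have hmem := circleMap_zero_mem_unitDisk hr₀.le hr₁
  have hdz := hf.continuousOn_dz.comp_continuous (continuous_circleMap 0 r) hmem
  have hdzbar := hf.continuousOn_dzbar.comp_continuous (continuous_circleMap 0 r) hmem
  have hdiff : DifferentiableOn ℂ (deriv q) (closedBall 0 r) := fun z hz =>
    (hq.analyticAt_of_mem (eball_zero_one ▸ closedBall_zero_subset_unitDisk hr₁ hz)).deriv
      |>.differentiableAt.differentiableWithinAt
  have hcoeff : ‖(a + c • Function.update b 0 0) n‖ = ‖a n‖ + ‖b n‖ := by
    rw [← hnorm, Pi.add_apply, Pi.smul_apply, Function.update_of_ne hn, smul_eq_mul]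
  rw [← hcoeff]
  refine (mul_norm_coeff_mul_pow_le hr₀ hq.hasFPowerSeriesAt hdiff n).trans ?_
  gcongr
  refine intervalIntegral.integral_mono Real.two_pi_pos.le
    (Continuous.intervalIntegrable (by simp_rw [fun θ => hderiv _ (hmem θ)]; fun_prop) _ _)
    (Continuous.intervalIntegrable (by unfold bigLambda; fun_prop) _ _) fun θ => ?_
  simp only [hderiv _ (hmem θ)]
  exact norm_dz_add_mul_conj_dzbar_le f _ hc

theorem IsQuasiregularHarmonic.norm_coeff_add_le {K : ℝ} (hf : IsQuasiregularHarmonic K f)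
    (hb : boundaryLength f < ⊤) (hab : HasHarmonicExpansion f a b) {n : ℕ} (hn : n ≠ 0) :
    ‖a n‖ + ‖b n‖ ≤ K * (boundaryLength f).toReal / (2 * n * π) := by
  have hlim : Tendsto (fun r : ℝ => n * (‖a n‖ + ‖b n‖) * r ^ n) (𝓝[<] 1)
      (𝓝 (n * (‖a n‖ + ‖b n‖) * 1 ^ n)) :=
    (Continuous.tendsto (by fun_prop) _).mono_left nhdsWithin_le_nhds
  have hbound : n * (‖a n‖ + ‖b n‖) ≤ (2 * π)⁻¹ * (K * (boundaryLength f).toReal) := by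
    rw [one_pow, mul_one] at hlim
    refine le_of_tendsto hlim ?_
    filter_upwards [Ioo_mem_nhdsLT one_pos] with r hr
    refine (hab.mul_norm_coeff_add_mul_pow_le hf.harmonic hr.1 hr.2 hn).trans
      (mul_le_mul_of_nonneg_left ?_ (by positivity))
    exact (hf.integral_bigLambda_le hr.1.le hr.2).trans
      (mul_le_mul_of_nonneg_left (circleLength_le_toReal_boundaryLength hb hr) hf.constant_nonneg)
  rw [le_div_iff₀ (by positivity)]
  calc (‖a n‖ + ‖b n‖) * (2 * n * π) = 2 * π * (n * (‖a n‖ + ‖b n‖)) := by ring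
    _ ≤ 2 * π * ((2 * π)⁻¹ * (K * (boundaryLength f).toReal)) := by gcongr
    _ = K * (boundaryLength f).toReal := mul_inv_cancel_left₀ Real.two_pi_pos.ne' _

end Coefficients

section Identity

theorem dz_id (z : ℂ) : dz (fun z => z) z = 1 := by simp [dz]

theorem dzbar_id (z : ℂ) : dzbar (fun z => z) z = 0 := by simp [dzbar]

theorem circleLength_id (r : ℝ) : circleLength (fun z => z) r = r * (2 * π) := by
  simp [circleLength, dz_id, dzbar_id]

theorem boundaryLength_id : boundaryLength (fun z => z) = ENNReal.ofReal (2 * π) := by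
  simp only [boundaryLength, circleLength_id]
  refine le_antisymm (iSup₂_le fun r hr => ENNReal.ofReal_le_ofReal
    (mul_le_of_le_one_left Real.two_pi_pos.le hr.2.le)) ?_
  have hlim : Tendsto (fun r : ℝ => ENNReal.ofReal (r * (2 * π))) (𝓝[<] 1)
      (𝓝 (ENNReal.ofReal (1 * (2 * π)))) :=
    ((ENNReal.continuous_ofReal.comp (continuous_mul_const _)).tendsto _).mono_left
      nhdsWithin_le_nhds
  rw [one_mul] at hlim
  refine le_of_tendsto hlim ?_
  filter_upwards [Ioo_mem_nhdsLT one_pos] with r hr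
  exact le_iSup₂ (f := fun r (_ : r ∈ Ioo 0 1) => ENNReal.ofReal (r * (2 * π))) r hr

theorem toReal_boundaryLength_id : (boundaryLength fun z => z).toReal = 2 * π := by
  rw [boundaryLength_id, ENNReal.toReal_ofReal Real.two_pi_pos.le]

theorem isQuasiconformalHarmonic_id : IsQuasiconformalHarmonic 1 (fun z => z) where
  one_le := le_rfl
  harmonic := ⟨fun _ _ => (analyticAt_id (𝕜 := ℂ)).harmonicAt_re,
    fun _ _ => (analyticAt_id (𝕜 := ℂ)).harmonicAt_im⟩
  sensePreserving _ _ := by simp [jacobian, dz_id, dzbar_id]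
  quasiregular _ _ := by simp [bigLambda, smallLambda, dz_id, dzbar_id]
  univalent := injOn_id _

theorem hasHarmonicExpansion_id : HasHarmonicExpansion (fun z => z) (Pi.single 1 1) 0 := by
  intro z _
  have hsum : HasSum (fun n => (Pi.single 1 1 : ℕ → ℂ) n * z ^ n) z := by
    simpa using hasSum_single (f := fun n => (Pi.single 1 1 : ℕ → ℂ) n * z ^ n) 1
      (fun n hn => by simp [hn])
  refine ⟨hsum.summable, by simp [summable_zero], ?_⟩
  rw [hsum.tsum_eq]
  simp

end Identity

end PlanarHarmonic

end

theorem theorem3_general {K : ℝ} {f : ℂ → ℂ} (hf : PlanarHarmonic.IsQuasiregularHarmonic K f)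
    (hb : PlanarHarmonic.boundaryLength f < ⊤) :
    (∀ a b : ℕ → ℂ, PlanarHarmonic.HasHarmonicExpansion f a b → ∀ n : ℕ, 1 ≤ n →
      ‖a n‖ + ‖b n‖ ≤
        K * (PlanarHarmonic.boundaryLength f).toReal / (2 * (n : ℝ) * Real.pi)) ∧
    (∀ z ∈ PlanarHarmonic.unitDisk,
      PlanarHarmonic.bigLambda f z ≤
        (PlanarHarmonic.boundaryLength f).toReal * Real.sqrt K / (2 * Real.pi * (1 - ‖z‖))) ∧
    PlanarHarmonic.IsHarmonicBloch f ∧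
    PlanarHarmonic.lipschitzNumber f ≤
      ENNReal.ofReal ((PlanarHarmonic.boundaryLength f).toReal * Real.sqrt K / Real.pi) :=
  ⟨fun _ _ hab _ hn => hf.norm_coeff_add_le hb hab (Nat.one_le_iff_ne_zero.1 hn),
    fun _ hz => hf.bigLambda_le hb hz, hf.isHarmonicBloch hb, hf.lipschitzNumber_le hb⟩

theorem theorem3 :
    (∀ (K : ℝ) (f : ℂ → ℂ), PlanarHarmonic.IsQuasiconformalHarmonic K f →
      PlanarHarmonic.boundaryLength f < ⊤ →
        (∀ a b : ℕ → ℂ, PlanarHarmonic.HasHarmonicExpansion f a b → ∀ n : ℕ, 1 ≤ n →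
          ‖a n‖ + ‖b n‖ ≤
            K * (PlanarHarmonic.boundaryLength f).toReal / (2 * (n : ℝ) * Real.pi)) ∧
        (∀ z ∈ PlanarHarmonic.unitDisk,
          PlanarHarmonic.bigLambda f z ≤
            (PlanarHarmonic.boundaryLength f).toReal * Real.sqrt K /
              (2 * Real.pi * (1 - ‖z‖))) ∧
        PlanarHarmonic.IsHarmonicBloch f ∧
        PlanarHarmonic.lipschitzNumber f ≤
          ENNReal.ofReal ((PlanarHarmonic.boundaryLength f).toReal * Real.sqrt K / Real.pi)) ∧
    -- sharpness for `K = 1`: the identity is admissible and attains both estimates,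
    -- the first one at `n = 1`, the second one at `z = 0`
    (PlanarHarmonic.IsQuasiconformalHarmonic 1 (fun z : ℂ => z) ∧
      PlanarHarmonic.boundaryLength (fun z : ℂ => z) < ⊤ ∧
      (∃ a b : ℕ → ℂ, PlanarHarmonic.HasHarmonicExpansion (fun z : ℂ => z) a b ∧
        ‖a 1‖ + ‖b 1‖ =
          1 * (PlanarHarmonic.boundaryLength (fun z : ℂ => z)).toReal /
            (2 * ((1 : ℕ) : ℝ) * Real.pi)) ∧
      PlanarHarmonic.bigLambda (fun z : ℂ => z) 0 =
        (PlanarHarmonic.boundaryLength (fun z : ℂ => z)).toReal * Real.sqrt 1 /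
          (2 * Real.pi * (1 - ‖(0 : ℂ)‖))) :=
  ⟨fun _ _ hf hb => theorem3_general hf.isQuasiregularHarmonic hb,
    PlanarHarmonic.isQuasiconformalHarmonic_id,
    PlanarHarmonic.boundaryLength_id ▸ ENNReal.ofReal_lt_top,
    ⟨_, _, PlanarHarmonic.hasHarmonicExpansion_id, by
      simp [PlanarHarmonic.toReal_boundaryLength_id]⟩,
    by simp [PlanarHarmonic.toReal_boundaryLength_id, PlanarHarmonic.bigLambda,
      PlanarHarmonic.dz_id, PlanarHarmonic.dzbar_id]⟩
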